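/- Let $R$ be a commutative ring and $\pi\in R$ such that one of the following holds: 1. $R$ is a Dedekind domain and $\pi$ is an arbitrary prime element of $R$; 2. $R=R_0[t]$ is the polynomial ring in one variable over a Bezout domain $R_0$ (an integral domain in which every finitely generated ideal is principal), and $\pi=t$. For $a,b\in R[1/\pi]$ write $D(a,b)=\begin{pmatrix}a&0\\0&b\end{pmatrix}$. Then $$SL_2(R[1/\pi])=\big\langle\, SL_2(R)\cup D(1/\pi,1)\,SL_2(R)\,D(\pi,1)\,\big\rangle .$$ Moreover, put $$B=SL_2\begin{pmatrix}R&\pi^{-1}R\\ \pi R&R\end{pmatrix},\qquad U=SL_2\begin{pmatrix}R&R\\ \pi R&R\end{pmatrix},$$ the subgroups of $SL_2(R[1/\pi])$ consisting of the matrices of determinant $1$ whose entries lie in the indicated subsets of $R[1/\pi]$. Then $U=SL_2(R)\cap B$, and $SL_2(R[1/\pi])$ is the free product of its subgroups $SL_2(R)$ and $B$ with amalgamation along $U$, $$SL_2(R[1/\pi])=SL_2(R)\,*_U\,B,$$ i.e. the canonical homomorphism from the pushout of $SL_2(R)\leftarrow U\to B$ to $SL_2(R[1/\pi])$ is an isomorphism.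 -/

import Mathlib

open Matrix Polynomial
open scoped MatrixGroups

universe u v

/-- For a family of subgroups `K i` of `G` all containing `U`, the canonical homomorphism to `G`
from the amalgamated product of the `K i` along `U` (the pushout of the inclusions `U → K i`),
induced by the inclusions `K i → G`. -/
def amalgamToGroup {G : Type*} [Group G] {ι : Type*} (K : ι → Subgroup G) (U : Subgroup G)
    (h : ∀ i, U ≤ K i) :
    Monoid.PushoutI (fun i => Subgroup.inclusion (h i)) →* G :=
  Monoid.PushoutI.lift (fun i => (K i).subtype) U.subtype (fun _ => rfl)

/-- `G = A *_U B`: the group `G` is the free product of its subgroups `A` and `B` with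
amalgamation along their intersection `U`, i.e. `U = A ⊓ B` and the canonical homomorphism
from the pushout of `A ← U → B` to `G` is an isomorphism. -/
def IsAmalgam {G : Type*} [Group G] (A B U : Subgroup G) : Prop :=
  U = A ⊓ B ∧ ∃ h : ∀ i : Fin 2, U ≤ ![A, B] i, Function.Bijective (amalgamToGroup ![A, B] U h)

/-- The image of `SL₂(R)` in `SL₂(S)`, for an `R`-algebra `S`. -/
def imageSL2 (R : Type u) (S : Type v) [CommRing R] [CommRing S] [Algebra R S] :
    Subgroup SL(2, S) :=
  (Matrix.SpecialLinearGroup.map (algebraMap R S)).range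

/-- The diagonal matrix `D(a, b)`. -/
def diagMat {S : Type*} [CommRing S] (a b : S) : Matrix (Fin 2) (Fin 2) S :=
  !![a, 0; 0, b]

/-- The subset `D(1/π, 1) SL₂(R) D(π, 1)` of `SL₂(S)`, where `S = R[1/π]`. -/
def conjSL2 (R : Type u) (S : Type v) [CommRing R] [CommRing S] [Algebra R S] (π : R)
    [IsLocalization.Away π S] : Set SL(2, S) :=
  {h | ∃ g ∈ imageSL2 R S, (h : Matrix (Fin 2) (Fin 2) S) =
    diagMat (IsLocalization.Away.invSelf π) 1 * (g : Matrix (Fin 2) (Fin 2) S) *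
      diagMat (algebraMap R S π) 1}

/-- For `R`-submodules `I`, `J` of `S` with `I * J ⊆ R` (here `R` stands for its image in `S`,
the submodule `1`), the group `SL₂([[R, I], [J, R]])` of all matrices of determinant one with
diagonal entries in `R`, upper right entry in `I` and lower left entry in `J`. -/
def patternSL2 {R : Type u} {S : Type v} [CommRing R] [CommRing S] [Algebra R S]
    (I J : Submodule R S) (hIJ : I * J ≤ 1) : Subgroup SL(2, S) where
  carrier := {g | g 0 0 ∈ (1 : Submodule R S) ∧ g 0 1 ∈ I ∧ g 1 0 ∈ J ∧
    g 1 1 ∈ (1 : Submodule R S)}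
  one_mem' := by
    simpa using (⟨1, map_one _⟩ : ∃ y, algebraMap R S y = 1)
  mul_mem' := by
    rintro g h ⟨g1, g2, g3, g4⟩ ⟨h1, h2, h3, h4⟩
    have key : ∀ {P Q T : Submodule R S}, P * Q ≤ T → ∀ {x y : S}, x ∈ P → y ∈ Q → x * y ∈ T :=
      fun hle _ _ hx hy => hle (Submodule.mul_mem_mul hx hy)
    have hJI : J * I ≤ 1 := by rwa [mul_comm]
    simp only [Set.mem_ofPred_eq, Matrix.SpecialLinearGroup.coe_mul, Matrix.mul_apply,
      Fin.sum_univ_two]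
    refine ⟨add_mem (key (one_mul _).le g1 h1) (key hIJ g2 h3),
      add_mem (key (one_mul _).le g1 h2) (key (mul_one _).le g2 h4),
      add_mem (key (mul_one _).le g3 h1) (key (one_mul _).le g4 h3),
      add_mem (key hJI g3 h2) (key (one_mul _).le g4 h4)⟩
  inv_mem' := by
    rintro g ⟨g1, g2, g3, g4⟩
    simp only [Matrix.SpecialLinearGroup.SL2_inv_expl]
    exact ⟨g4, neg_mem g2, neg_mem g3, g1⟩

/-- The group `SL₂([[R, π⁻¹R], [πR, R]])` inside `SL₂(S)`, where `S = R[1/π]`. -/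
noncomputable def twistedSL2 (R : Type u) (S : Type v) [CommRing R] [CommRing S] [Algebra R S]
    (π : R) [IsLocalization.Away π S] : Subgroup SL(2, S) :=
  patternSL2 (R := R) (Submodule.span R {IsLocalization.Away.invSelf π})
    (Submodule.span R {algebraMap R S π}) (by
      rw [Submodule.span_mul_span, Set.singleton_mul_singleton, mul_comm,
        IsLocalization.Away.mul_invSelf, Submodule.one_eq_span])

/-- The group `SL₂([[R, R], [πR, R]])` inside `SL₂(S)`, for an `R`-algebra `S`. -/
def lowerSL2 (R : Type u) (S : Type v) [CommRing R] [CommRing S] [Algebra R S]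
    (π : R) : Subgroup SL(2, S) :=
  patternSL2 (R := R) 1 (Submodule.span R {algebraMap R S π}) (by
    rw [one_mul, Submodule.span_singleton_le_iff_mem]
    exact Submodule.algebraMap_mem π)

/-! Write A = SL₂(R). The only arithmetic input is `ResidualReduction`: modulo π, A can kill the
second entry of any vector. It holds when R/π is a field, and for R₀[t] because a Bezout matrix over
R₀ = R/t lifts to constants.

Generation (`mem_sup_of_pow_mul_integral`): if π^(n+1)g is integral, its determinant is π^(2n+2), so
reduction modulo π can be used twice, giving γ in A and β in B such that π^n βγg is integral. Induct
on n.

Injectivity is ping-pong on the vector (0,1): a letter of B \ U raises the denominator exponent by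
one, and a following letter of A \ U preserves it (`PingPong.twistedSL2_mulVec`,
`PingPong.imageSL2_mulVec`). So an alternating word ending in B makes (0,1) nonintegral and cannot
lie in A; a final letter from A is stripped first. `amalgamToGroup_injective` turns this into
injectivity. -/

/-! ### Reduction modulo π -/

/-- Every pair of elements of `R` can be moved by `SL₂(R)` to a pair whose second entry is
divisible by `π`. Only the second row `(r, s)` of the matrix is relevant for divisibility. -/
def ResidualReduction {R : Type*} [CommRing R] (π : R) : Prop :=
  ∀ a b : R, ∃ p q r s : R, p * s - q * r = 1 ∧ π ∣ r * a + s * b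

theorem ResidualReduction.of_isDedekindDomain {R : Type*} [CommRing R] [IsDedekindDomain R]
    {π : R} (hπ : Prime π) : ResidualReduction π := by
  intro a b
  have hmax : (Ideal.span {π}).IsMaximal :=
    ((Ideal.span_singleton_prime hπ.ne_zero).2 hπ).isMaximal
      (by simpa [Ideal.span_singleton_eq_bot] using hπ.ne_zero)
  by_cases ha : π ∣ a
  · exact ⟨0, -1, 1, 0, by ring, by simpa using ha⟩
  · obtain ⟨y, t, ht, hy⟩ := hmax.exists_inv (x := a)
      (by rwa [Ideal.mem_span_singleton])
    rw [Ideal.mem_span_singleton] at ht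
    -- Since y inverts a modulo π, adding -by times the first entry to the second clears b.
    refine ⟨1, 0, -b * y, 1, by ring, ?_⟩
    have : -b * y * a + 1 * b = t * b := by linear_combination (-b) * hy
    exact this ▸ ht.mul_right b

/-- Only constant terms matter. Dividing them by their gcd d leaves a unimodular pair (a, b), and
the row (-b, a) kills it; its Bezout coefficients complete the matrix. -/
theorem ResidualReduction.X_of_isBezout (R : Type*) [CommRing R] [IsDomain R] [IsBezout R] :
    ResidualReduction (X : R[X]) := by
  intro f g
  obtain ⟨x, y, hxy⟩ := IsBezout.gcd_eq_sum (f.coeff 0) (g.coeff 0)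
  obtain ⟨a, ha⟩ := IsBezout.gcd_dvd_left (f.coeff 0) (g.coeff 0)
  obtain ⟨b, hb⟩ := IsBezout.gcd_dvd_right (f.coeff 0) (g.coeff 0)
  generalize IsBezout.gcd (f.coeff 0) (g.coeff 0) = d at hxy ha hb
  by_cases hd : d = 0
  · refine ⟨1, 0, 0, 1, by ring, ?_⟩
    simp [X_dvd_iff, hb, hd]
  · have h1 : x * a + y * b = 1 := by
      apply mul_left_cancel₀ hd
      linear_combination hxy - x * ha - y * hb
    refine ⟨C x, C y, C (-b), C a, ?_, ?_⟩
    · rw [← C_mul, ← C_mul, ← C_sub, ← C_1]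
      congr 1
      linear_combination h1
    · rw [X_dvd_iff]
      simp only [coeff_add, coeff_C_mul]
      linear_combination (-b) * ha + a * hb

theorem ResidualReduction.map_ringEquiv {R R' : Type*} [CommRing R] [CommRing R'] {π : R}
    (h : ResidualReduction π) (e : R ≃+* R') : ResidualReduction (e π) := by
  intro a b
  obtain ⟨p, q, r, s, h1, h2⟩ := h (e.symm a) (e.symm b)
  refine ⟨e p, e q, e r, e s, ?_, ?_⟩
  · simpa using congrArg e h1
  · simpa using map_dvd e h2

/-- If `π` divides the determinant of a matrix, the matrix can be moved by `SL₂(R)` to one whose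
second row is divisible by `π`. -/
theorem ResidualReduction.exists_row {R : Type*} [CommRing R] {π : R} (h : ResidualReduction π)
    (hπ : Prime π) {a b c d : R} (hdet : π ∣ a * d - b * c) :
    ∃ p q r s : R, p * s - q * r = 1 ∧ π ∣ r * a + s * c ∧ π ∣ r * b + s * d := by
  -- If the first column vanishes modulo π, treat the second. Otherwise treat the first: since the
  -- determinant vanishes modulo π, both a and c times the other new entry are divisible by π, and
  -- one of a, c is not.
  by_cases hac : π ∣ a ∧ π ∣ c
  · obtain ⟨p, q, r, s, h1, h2⟩ := h b d
    exact ⟨p, q, r, s, h1, dvd_add (hac.1.mul_left r) (hac.2.mul_left s), h2⟩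
  · obtain ⟨p, q, r, s, h1, h2⟩ := h a c
    refine ⟨p, q, r, s, h1, h2, ?_⟩
    have ha : π ∣ a * (r * b + s * d) := by
      have : a * (r * b + s * d) = b * (r * a + s * c) + s * (a * d - b * c) := by ring
      exact this ▸ dvd_add (h2.mul_left b) (hdet.mul_left s)
    have hc : π ∣ c * (r * b + s * d) := by
      have : c * (r * b + s * d) = d * (r * a + s * c) - r * (a * d - b * c) := by ring
      exact this ▸ dvd_sub (h2.mul_left d) (hdet.mul_left r)
    rcases hπ.dvd_or_dvd ha with ha | ha
    · rcases hπ.dvd_or_dvd hc with hc | hc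
      · exact absurd ⟨ha, hc⟩ hac
      · exact hc
    · exact ha

/-! ### Injectivity criterion for amalgams -/

/-- A family of subgroups generates an amalgamated product if no nonempty alternating product of
elements outside of the common subgroup `U` lies in `U`. -/
theorem amalgamToGroup_injective {G : Type*} [Group G] {ι : Type*} (K : ι → Subgroup G)
    (U : Subgroup G) (h : ∀ i, U ≤ K i)
    (hU : ∀ l : List (Σ i, K i), (l.IsChain fun x y => x.1 ≠ y.1) →
      (∀ x ∈ l, (x.2 : G) ∉ U) → (l.map fun x => (x.2 : G)).prod ∈ U → l = []) :
    Function.Injective (amalgamToGroup K U h) := by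
  classical
  obtain ⟨d⟩ := Monoid.PushoutI.NormalWord.transversal_nonempty
    (fun i => Subgroup.inclusion (h i)) (fun i => Subgroup.inclusion_injective (h i))
  rw [injective_iff_map_eq_one]
  intro x hx
  obtain ⟨w, rfl⟩ : ∃ w : Monoid.PushoutI.NormalWord d, w.prod = x :=
    ⟨Monoid.PushoutI.NormalWord.equiv x, Monoid.PushoutI.NormalWord.equiv.symm_apply_apply x⟩
  have hword : ∀ l : List (Σ i, K i), amalgamToGroup K U h (Monoid.PushoutI.ofCoprodI
      (l.map fun x => Monoid.CoprodI.of x.2).prod) = (l.map fun x => (x.2 : G)).prod := by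
    intro l
    induction l with
    | nil => simp
    | cons a l ih =>
      simp only [List.map_cons, List.prod_cons, map_mul, ih, Monoid.PushoutI.ofCoprodI_of]
      congr 1
  have hprod : (w.head : G) * (w.toList.map fun x => (x.2 : G)).prod = 1 := by
    rw [← hword, ← hx, Monoid.PushoutI.NormalWord.prod, map_mul]
    congr 1
  have hnil : w.toList = [] := by
    refine hU _ w.chain_ne ?_ ?_
    · rintro ⟨i, g⟩ hg hgU
      refine w.ne_one _ hg ?_
      have hinj := (d.compl i).1
      -- A letter g in U factors through the transversal as both g·1 and 1·g; uniqueness forces g =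
      -- 1.
      have := @hinj (⟨g, ⟨⟨g, hgU⟩, rfl⟩⟩, ⟨1, d.one_mem i⟩)
        (1, ⟨g, w.normalized i g hg⟩) (by simp)
      simpa using (congrArg (fun z => (z.2 : K i)) this).symm
    · rw [eq_inv_of_mul_eq_one_right hprod]
      exact inv_mem w.head.2
  have hhead : w.head = 1 := by
    rw [hnil] at hprod
    simpa using hprod
  have hempty : w = Monoid.PushoutI.NormalWord.empty :=
    Monoid.PushoutI.NormalWord.ext hhead hnil
  rw [hempty, Monoid.PushoutI.NormalWord.prod_empty]

/-! ### Subgroups of SL₂(R[1/π]) -/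

section Localization

variable {R : Type u} {S : Type v} [CommRing R] [CommRing S] [Algebra R S]

theorem mem_one_iff {x : S} : x ∈ (1 : Submodule R S) ↔ ∃ a : R, x = algebraMap R S a := by
  rw [Submodule.mem_one]
  exact ⟨fun ⟨a, h⟩ => ⟨a, h.symm⟩, fun ⟨a, h⟩ => ⟨a, h.symm⟩⟩

theorem mem_span_algebraMap_iff {x : S} (c : S) :
    x ∈ Submodule.span R {c} ↔ ∃ a : R, x = algebraMap R S a * c := by
  rw [Submodule.mem_span_singleton]
  simp only [Algebra.smul_def, eq_comm]

theorem mem_imageSL2_iff (hinj : Function.Injective (algebraMap R S)) (g : SL(2, S)) :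
    g ∈ imageSL2 R S ↔ g 0 0 ∈ (1 : Submodule R S) ∧ g 0 1 ∈ (1 : Submodule R S) ∧
      g 1 0 ∈ (1 : Submodule R S) ∧ g 1 1 ∈ (1 : Submodule R S) := by
  simp only [mem_one_iff]
  constructor
  · rintro ⟨m, rfl⟩
    exact ⟨⟨m 0 0, rfl⟩, ⟨m 0 1, rfl⟩, ⟨m 1 0, rfl⟩, ⟨m 1 1, rfl⟩⟩
  · rintro ⟨⟨a, ha⟩, ⟨b, hb⟩, ⟨c, hc⟩, ⟨d, hd⟩⟩
    have hdet := g.det_coe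
    rw [Matrix.det_fin_two, ha, hb, hc, hd] at hdet
    refine ⟨⟨!![a, b; c, d], ?_⟩, ?_⟩
    · rw [Matrix.det_fin_two_of]
      apply hinj
      simpa using hdet
    · ext i j
      fin_cases i <;> fin_cases j
      · exact ha.symm
      · exact hb.symm
      · exact hc.symm
      · exact hd.symm

theorem mem_lowerSL2_iff (π : R) (g : SL(2, S)) :
    g ∈ lowerSL2 R S π ↔ g 0 0 ∈ (1 : Submodule R S) ∧ g 0 1 ∈ (1 : Submodule R S) ∧
      g 1 0 ∈ Submodule.span R {algebraMap R S π} ∧ g 1 1 ∈ (1 : Submodule R S) :=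
  Iff.rfl

variable (π : R) [IsLocalization.Away π S]

theorem mem_twistedSL2_iff (g : SL(2, S)) :
    g ∈ twistedSL2 R S π ↔ g 0 0 ∈ (1 : Submodule R S) ∧
      g 0 1 ∈ Submodule.span R {IsLocalization.Away.invSelf π} ∧
      g 1 0 ∈ Submodule.span R {algebraMap R S π} ∧ g 1 1 ∈ (1 : Submodule R S) :=
  Iff.rfl

theorem span_algebraMap_le_one (c : R) : Submodule.span R {algebraMap R S c} ≤ 1 := by
  rw [Submodule.span_singleton_le_iff_mem]
  exact Submodule.algebraMap_mem c

theorem one_le_span_invSelf :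
    (1 : Submodule R S) ≤ Submodule.span R {IsLocalization.Away.invSelf π} := by
  rw [Submodule.one_le, mem_span_algebraMap_iff]
  exact ⟨π, (IsLocalization.Away.mul_invSelf π).symm⟩

theorem lowerSL2_eq_inf (hinj : Function.Injective (algebraMap R S)) :
    lowerSL2 R S π = imageSL2 R S ⊓ twistedSL2 R S π := by
  ext g
  rw [Subgroup.mem_inf, mem_imageSL2_iff hinj, mem_twistedSL2_iff, mem_lowerSL2_iff]
  have h1 := @span_algebraMap_le_one R S _ _ _ π (g 1 0)
  have h2 := @one_le_span_invSelf R S _ _ _ π _ (g 0 1)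
  tauto

theorem twistedSL2_subset_conjSL2 (hinj : Function.Injective (algebraMap R S)) :
    (twistedSL2 R S π : Set SL(2, S)) ⊆ conjSL2 R S π := by
  intro g hg
  rw [SetLike.mem_coe, mem_twistedSL2_iff] at hg
  simp only [mem_one_iff, mem_span_algebraMap_iff] at hg
  obtain ⟨⟨a, ha⟩, ⟨b, hb⟩, ⟨c, hc⟩, ⟨d, hd⟩⟩ := hg
  have hinv : algebraMap R S π * IsLocalization.Away.invSelf π = 1 :=
    IsLocalization.Away.mul_invSelf π
  have hdet := g.det_coe
  rw [Matrix.det_fin_two, ha, hb, hc, hd] at hdet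
  refine ⟨⟨!![algebraMap R S a, algebraMap R S b; algebraMap R S c, algebraMap R S d], ?_⟩,
    (mem_imageSL2_iff hinj _).2 ?_, ?_⟩
  · rw [Matrix.det_fin_two_of]
    linear_combination hdet + algebraMap R S b * algebraMap R S c * hinv
  · exact ⟨Submodule.algebraMap_mem a, Submodule.algebraMap_mem b, Submodule.algebraMap_mem c,
      Submodule.algebraMap_mem d⟩
  · ext i j
    fin_cases i <;> fin_cases j <;>
      simp [diagMat, Matrix.mul_apply, Fin.sum_univ_two, ha, hb, hc, hd]
    · linear_combination (-algebraMap R S a) * hinv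
    · ring

/-! ### Generation by clearing denominators -/

theorem exists_pow_mul_eq_algebraMap (g : SL(2, S)) :
    ∃ n : ℕ, ∀ i j, ∃ a : R, algebraMap R S π ^ n * g i j = algebraMap R S a := by
  choose n a h using fun i j => IsLocalization.Away.surj π (g i j)
  refine ⟨∑ i, ∑ j, n i j, fun i j => ?_⟩
  have hle : n i j ≤ ∑ i, ∑ j, n i j :=
    (Finset.single_le_sum (f := fun j => n i j) (fun _ _ => Nat.zero_le _)
      (Finset.mem_univ j)).trans
      (Finset.single_le_sum (f := fun i => ∑ j, n i j) (fun _ _ => Nat.zero_le _)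
        (Finset.mem_univ i))
  obtain ⟨k, hk⟩ := Nat.exists_eq_add_of_le hle
  refine ⟨π ^ k * a i j, ?_⟩
  rw [hk, pow_add, map_mul, map_pow, ← h]
  ring

theorem mem_sup_of_pow_mul_integral [IsDomain R] (hπ : Prime π) (hred : ResidualReduction π)
    (hinj : Function.Injective (algebraMap R S)) (n : ℕ) : ∀ g : SL(2, S),
    (∀ i j, ∃ a : R, algebraMap R S π ^ n * g i j = algebraMap R S a) →
      g ∈ imageSL2 R S ⊔ twistedSL2 R S π := by
  have hinv : algebraMap R S π * IsLocalization.Away.invSelf π = 1 :=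
    IsLocalization.Away.mul_invSelf π
  induction n with
  | zero =>
    intro g hg
    refine Subgroup.mem_sup_left ((mem_imageSL2_iff hinj g).2 ?_)
    simp only [pow_zero, one_mul] at hg
    exact ⟨mem_one_iff.2 (hg 0 0), mem_one_iff.2 (hg 0 1), mem_one_iff.2 (hg 1 0),
      mem_one_iff.2 (hg 1 1)⟩
  | succ n ih =>
    intro g hg
    obtain ⟨a, ha⟩ := hg 0 0
    obtain ⟨b, hb⟩ := hg 0 1
    obtain ⟨c, hc⟩ := hg 1 0
    obtain ⟨d, hd⟩ := hg 1 1
    have hdet : a * d - b * c = π ^ (n + 1) * π ^ (n + 1) := by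
      apply hinj
      have := g.det_coe
      rw [Matrix.det_fin_two] at this
      simp only [map_sub, map_mul, map_pow, ← ha, ← hb, ← hc, ← hd]
      linear_combination algebraMap R S π ^ (n + 1) * algebraMap R S π ^ (n + 1) * this
    obtain ⟨p, q, r, s, hγ, ⟨x, hx⟩, ⟨y, hy⟩⟩ := hred.exists_row hπ (a := a) (b := b) (c := c)
      (d := d) (by rw [hdet, pow_succ]; exact Dvd.intro_left (π ^ n * (π ^ n * π)) (by ring))
    have hdet' : π ∣ (p * a + q * c) * y - (p * b + q * d) * x := by
      -- Dividing the second row by π leaves determinant π^(2n+1), still divisible by π, so a second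
      -- reduction is possible.
      refine ⟨π ^ n * π ^ n, mul_left_cancel₀ hπ.ne_zero ?_⟩
      linear_combination (a * d - b * c) * hγ + hdet - (p * a + q * c) * hy +
        (p * b + q * d) * hx
    obtain ⟨p', q', r', s', hγ', ⟨x', hx'⟩, ⟨y', hy'⟩⟩ := hred.exists_row hπ hdet'
    have hγS := congrArg (algebraMap R S) hγ
    have hγS' := congrArg (algebraMap R S) hγ'
    simp only [map_sub, map_mul, map_one] at hγS hγS'
    let γ : SL(2, S) := ⟨!![algebraMap R S p, algebraMap R S q; algebraMap R S r,
      algebraMap R S s], by rw [Matrix.det_fin_two_of, hγS]⟩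
    -- The second reducing matrix with its rows swapped (one sign changed), conjugated by D(1/π, 1).
    -- The swap puts the row that gains a factor π on top; the lower row gains one from the
    -- conjugation.
    let β : SL(2, S) := ⟨!![algebraMap R S r', algebraMap R S s' * IsLocalization.Away.invSelf π;
      algebraMap R S (-p') * algebraMap R S π, algebraMap R S (-q')], by
        rw [Matrix.det_fin_two_of, map_neg, map_neg]
        linear_combination hγS' + algebraMap R S p' * algebraMap R S s' * hinv⟩
    have hγ_mem : γ ∈ imageSL2 R S ⊔ twistedSL2 R S π :=
      Subgroup.mem_sup_left ((mem_imageSL2_iff hinj _).2 ⟨Submodule.algebraMap_mem _,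
        Submodule.algebraMap_mem _, Submodule.algebraMap_mem _, Submodule.algebraMap_mem _⟩)
    have hβ_mem : β ∈ imageSL2 R S ⊔ twistedSL2 R S π :=
      Subgroup.mem_sup_right ((mem_twistedSL2_iff π _).2 ⟨Submodule.algebraMap_mem _,
        (mem_span_algebraMap_iff _).2 ⟨s', rfl⟩, (mem_span_algebraMap_iff _).2 ⟨-p', rfl⟩,
        Submodule.algebraMap_mem _⟩)
    have hcancel : ∀ {u v : S}, algebraMap R S π * u = algebraMap R S π * v → u = v :=
      fun h => (IsLocalization.Away.algebraMap_isUnit π).mul_left_cancel h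
    have hxS := congrArg (algebraMap R S) hx
    have hyS := congrArg (algebraMap R S) hy
    have hxS' := congrArg (algebraMap R S) hx'
    have hyS' := congrArg (algebraMap R S) hy'
    simp only [map_add, map_mul] at hxS hyS hxS' hyS'
    have key : β * (γ * g) ∈ imageSL2 R S ⊔ twistedSL2 R S π := by
      apply ih
      -- the columns of `γ * g` scaled by `π ^ (n + 1)` are `(p a + q c, π x)`, `(p b + q d, π y)`
      have hcol : ∀ (j : Fin 2) (a c x x' : R),
          algebraMap R S π ^ (n + 1) * g 0 j = algebraMap R S a →
          algebraMap R S π ^ (n + 1) * g 1 j = algebraMap R S c →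
          algebraMap R S r * algebraMap R S a + algebraMap R S s * algebraMap R S c =
            algebraMap R S π * algebraMap R S x →
          algebraMap R S r' * (algebraMap R S p * algebraMap R S a +
            algebraMap R S q * algebraMap R S c) + algebraMap R S s' * algebraMap R S x =
            algebraMap R S π * algebraMap R S x' →
          ∀ i, ∃ z : R, algebraMap R S π ^ n * (β * (γ * g)) i j = algebraMap R S z := by
        intro j a c x x' ha hc hx hx' i
        have hmul : ∀ (A B : SL(2, S)) (i j : Fin 2), (A * B) i j = A i 0 * B 0 j + A i 1 * B 1 j :=
          fun A B i j => by
            rw [Matrix.SpecialLinearGroup.coe_mul, Matrix.mul_apply, Fin.sum_univ_two]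
        have h0 : algebraMap R S π ^ (n + 1) * (γ * g) 0 j =
            algebraMap R S p * algebraMap R S a + algebraMap R S q * algebraMap R S c := by
          have : (γ * g) 0 j = algebraMap R S p * g 0 j + algebraMap R S q * g 1 j := hmul ..
          rw [this, ← ha, ← hc]
          ring
        have h1 : algebraMap R S π ^ (n + 1) * (γ * g) 1 j =
            algebraMap R S π * algebraMap R S x := by
          have : (γ * g) 1 j = algebraMap R S r * g 0 j + algebraMap R S s * g 1 j := hmul ..
          rw [this, ← hx, ← ha, ← hc]
          ring
        rw [hmul β]
        fin_cases i
        · refine ⟨x', hcancel ?_⟩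
          change algebraMap R S π * (algebraMap R S π ^ n * (algebraMap R S r' * (γ * g) 0 j +
            algebraMap R S s' * IsLocalization.Away.invSelf π * (γ * g) 1 j)) = _
          rw [← hx', ← h0]
          linear_combination algebraMap R S s' * IsLocalization.Away.invSelf π * h1 +
            algebraMap R S s' * algebraMap R S x * hinv
        · refine ⟨-p' * (p * a + q * c) - q' * x, hcancel ?_⟩
          change algebraMap R S π * (algebraMap R S π ^ n * (algebraMap R S (-p') *
            algebraMap R S π * (γ * g) 0 j + algebraMap R S (-q') * (γ * g) 1 j)) = _
          simp only [map_neg, map_sub, map_mul, map_add]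
          linear_combination (-algebraMap R S p' * algebraMap R S π) * h0 -
            algebraMap R S q' * h1
      intro i j
      fin_cases j
      · exact hcol 0 a c x x' ha hc hxS hxS' i
      · exact hcol 1 b d y y' hb hd hyS hyS' i
    rwa [Subgroup.mul_mem_cancel_left _ hβ_mem, Subgroup.mul_mem_cancel_left _ hγ_mem] at key

theorem imageSL2_sup_twistedSL2 [IsDomain R] (hπ : Prime π) (hred : ResidualReduction π)
    (hinj : Function.Injective (algebraMap R S)) : imageSL2 R S ⊔ twistedSL2 R S π = ⊤ := by
  refine (Subgroup.eq_top_iff' _).2 fun g => ?_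
  obtain ⟨n, hn⟩ := exists_pow_mul_eq_algebraMap π g
  exact mem_sup_of_pow_mul_integral π hπ hred hinj n g hn

/-! ### Ping-pong on vectors -/

/-- The vector `v` is `π ^ (-n)` times an integral vector whose second entry is not divisible
by `π` (if `k = 0`), or whose first entry is not divisible by `π` but whose second entry is
(if `k = 1`). -/
def PingPong (k : Fin 2) (n : ℕ) (v : Fin 2 → S) : Prop :=
  ∃ x y : R, algebraMap R S π ^ n * v 0 = algebraMap R S x ∧
    algebraMap R S π ^ n * v 1 = algebraMap R S y ∧
    if k = 0 then ¬ π ∣ y else ¬ π ∣ x ∧ π ∣ y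

/-- Outside U the lower left entry r is prime to π, so rx + sy ≡ rx is nonzero modulo π. -/
theorem PingPong.imageSL2_mulVec {π : R} (hπ : Prime π)
    (hinj : Function.Injective (algebraMap R S)) {n : ℕ} {v : Fin 2 → S} (hv : PingPong π 1 n v)
    {g : SL(2, S)} (hg : g ∈ imageSL2 R S)
    (hgU : g ∉ lowerSL2 R S π) : PingPong π 0 n ((g : Matrix (Fin 2) (Fin 2) S) *ᵥ v) := by
  rw [mem_imageSL2_iff hinj] at hg
  simp only [mem_lowerSL2_iff, hg, true_and, and_true] at hgU
  simp only [mem_one_iff] at hg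
  rw [mem_span_algebraMap_iff] at hgU
  obtain ⟨⟨p, hp⟩, ⟨q, hq⟩, ⟨r, hr⟩, ⟨s, hs⟩⟩ := hg
  have hr' : ¬ π ∣ r := by
    rintro ⟨t, rfl⟩
    exact hgU ⟨t, by rw [hr, map_mul, mul_comm]⟩
  obtain ⟨x, y, hx, hy, hxy⟩ := hv
  simp only [one_ne_zero, if_false] at hxy
  refine ⟨p * x + q * y, r * x + s * y, ?_, ?_, ?_⟩
  · simp only [Matrix.mulVec, dotProduct, Fin.sum_univ_two, hp, hq, map_add, map_mul, ← hx, ← hy]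
    ring
  · simp only [Matrix.mulVec, dotProduct, Fin.sum_univ_two, hr, hs, map_add, map_mul, ← hx, ← hy]
    ring
  · rw [if_pos rfl, dvd_add_left (hxy.2.mul_left s)]
    exact hπ.not_dvd_mul hr' hxy.1

/-- Outside U the upper right entry is q/π with π ∤ q. Scaling by one more π gives first entry ≡ qy,
nonzero modulo π, and second entry divisible by π. -/
theorem PingPong.twistedSL2_mulVec {π : R} [IsLocalization.Away π S] (hπ : Prime π)
    {n : ℕ} {v : Fin 2 → S} (hv : PingPong π 0 n v) {g : SL(2, S)} (hg : g ∈ twistedSL2 R S π)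
    (hgU : g ∉ lowerSL2 R S π) :
    PingPong π 1 (n + 1) ((g : Matrix (Fin 2) (Fin 2) S) *ᵥ v) := by
  have hinv : algebraMap R S π * IsLocalization.Away.invSelf π = 1 :=
    IsLocalization.Away.mul_invSelf π
  rw [mem_twistedSL2_iff] at hg
  simp only [mem_lowerSL2_iff, hg, true_and, and_true] at hgU
  simp only [mem_one_iff, mem_span_algebraMap_iff] at hg hgU
  obtain ⟨⟨p, hp⟩, ⟨q, hq⟩, ⟨r, hr⟩, ⟨s, hs⟩⟩ := hg
  have hq' : ¬ π ∣ q := by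
    rintro ⟨t, rfl⟩
    refine hgU ⟨t, ?_⟩
    rw [hq, map_mul]
    linear_combination algebraMap R S t * hinv
  obtain ⟨x, y, hx, hy, hxy⟩ := hv
  rw [if_pos rfl] at hxy
  refine ⟨π * (p * x) + q * y, π * (π * (r * x) + s * y), ?_, ?_, ?_⟩
  · simp only [Matrix.mulVec, dotProduct, Fin.sum_univ_two, hp, hq, map_add, map_mul, ← hx, ← hy]
    linear_combination algebraMap R S π ^ n * algebraMap R S q * v 1 * hinv
  · simp only [Matrix.mulVec, dotProduct, Fin.sum_univ_two, hr, hs, map_add, map_mul, ← hx, ← hy]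
    ring
  · rw [if_neg one_ne_zero, dvd_add_right (dvd_mul_right π _)]
    exact ⟨hπ.not_dvd_mul hq' hxy, dvd_mul_right _ _⟩

theorem PingPong.not_integral {π : R} (hinj : Function.Injective (algebraMap R S))
    {k : Fin 2} {n : ℕ} {v : Fin 2 → S} (hv : PingPong π k (n + 1) v) :
    ¬ ∀ i, v i ∈ (1 : Submodule R S) := by
  intro h
  simp only [mem_one_iff] at h
  obtain ⟨a, ha⟩ := h 0
  obtain ⟨b, hb⟩ := h 1
  obtain ⟨x, y, hx, hy, hxy⟩ := hv
  rw [ha, ← map_pow, ← map_mul] at hx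
  rw [hb, ← map_pow, ← map_mul] at hy
  have hx' : π ∣ x := hinj hx ▸ (dvd_pow_self π n.succ_ne_zero).mul_right a
  have hy' : π ∣ y := hinj hy ▸ (dvd_pow_self π n.succ_ne_zero).mul_right b
  split_ifs at hxy
  · exact hxy hy'
  · exact hxy.1 hx'

theorem imageSL2_mulVec_mem_one (hinj : Function.Injective (algebraMap R S)) {g : SL(2, S)}
    (hg : g ∈ imageSL2 R S) (i : Fin 2) :
    ((g : Matrix (Fin 2) (Fin 2) S) *ᵥ ![0, 1]) i ∈ (1 : Submodule R S) := by
  rw [mem_imageSL2_iff hinj] at hg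
  fin_cases i
  · simpa [Matrix.mulVec, dotProduct, Fin.sum_univ_two] using hg.2.1
  · simpa [Matrix.mulVec, dotProduct, Fin.sum_univ_two] using hg.2.2.2

/-- Letters are prepended on the left; the type of the leading letter records which ping-pong set
contains the image of (0,1). The exponent is positive because the rightmost letter comes from B \ U.
-/
theorem pingPong_prod {π : R} [IsLocalization.Away π S] (hπ : Prime π)
    (hinj : Function.Injective (algebraMap R S))
    {b : SL(2, S)} (hb : b ∈ twistedSL2 R S π) (hbU : b ∉ lowerSL2 R S π) :
    ∀ (l : List (Σ i : Fin 2, (![imageSL2 R S, twistedSL2 R S π] i : Subgroup SL(2, S))))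
      (z : Σ i : Fin 2, (![imageSL2 R S, twistedSL2 R S π] i : Subgroup SL(2, S))),
      z.1 = 1 → (z.2 : SL(2, S)) = b →
      ((l ++ [z]).IsChain fun x y => x.1 ≠ y.1) → (∀ x ∈ l, (x.2 : SL(2, S)) ∉ lowerSL2 R S π) →
      ∀ x ∈ (l ++ [z]).head?, ∃ n, PingPong π x.1 (n + 1)
        ((((l ++ [z]).map fun x => (x.2 : SL(2, S))).prod : Matrix (Fin 2) (Fin 2) S) *ᵥ
          ![0, 1]) := by
  intro l z hz1 hz2
  have hbase : PingPong π 0 0 (![0, 1] : Fin 2 → S) :=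
    ⟨0, 1, by simp, by simp, by simpa using hπ.not_dvd_one⟩
  induction l with
  | nil =>
    intro _ _ x hx
    simp only [List.nil_append, List.head?_cons, Option.mem_def, Option.some.injEq] at hx
    subst hx
    rw [hz1]
    refine ⟨0, ?_⟩
    simpa [hz2] using hbase.twistedSL2_mulVec hπ hb hbU
  | cons a l ih =>
    intro hchain hl x hx
    simp only [List.cons_append, List.head?_cons, Option.mem_def, Option.some.injEq] at hx
    subst hx
    rw [List.cons_append, List.isChain_cons] at hchain
    obtain ⟨y, hy⟩ : ∃ y, y ∈ (l ++ [z]).head? := by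
      cases l <;> simp
    obtain ⟨n, hn⟩ := ih hchain.2 (fun x hx => hl x (List.mem_cons_of_mem _ hx)) y hy
    have hne := hchain.1 y hy
    have haU := hl a List.mem_cons_self
    rw [List.cons_append, List.map_cons, List.prod_cons, Matrix.SpecialLinearGroup.coe_mul,
      ← Matrix.mulVec_mulVec]
    generalize (((l ++ [z]).map fun x => (x.2 : SL(2, S))).prod : Matrix (Fin 2) (Fin 2) S) *ᵥ
      ![0, 1] = v at hn
    obtain ⟨i, a⟩ := a
    obtain ⟨j, y⟩ := y
    fin_cases i <;> fin_cases j
    · exact absurd rfl hne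
    · exact ⟨n, hn.imageSL2_mulVec hπ hinj a.2 haU⟩
    · exact ⟨n + 1, hn.twistedSL2_mulVec hπ a.2 haU⟩
    · exact absurd rfl hne

theorem amalgamToGroup_SL2_injective {π : R} [IsLocalization.Away π S] (hπ : Prime π)
    (hinj : Function.Injective (algebraMap R S))
    (h : ∀ i : Fin 2, lowerSL2 R S π ≤ ![imageSL2 R S, twistedSL2 R S π] i) :
    Function.Injective
      (amalgamToGroup ![imageSL2 R S, twistedSL2 R S π] (lowerSL2 R S π) h) := by
  have hUA : lowerSL2 R S π ≤ imageSL2 R S := h 0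
  refine amalgamToGroup_injective _ _ _ fun l hchain hl hprod => ?_
  -- an alternating word ending in a letter of `twistedSL2` does not represent an element of
  -- `imageSL2`
  have main : ∀ (l : List (Σ i : Fin 2, (![imageSL2 R S, twistedSL2 R S π] i :
      Subgroup SL(2, S)))) (z : Σ i : Fin 2, (![imageSL2 R S, twistedSL2 R S π] i :
      Subgroup SL(2, S))), z.1 = 1 → ((l ++ [z]).IsChain fun x y => x.1 ≠ y.1) →
      (∀ x ∈ l ++ [z], (x.2 : SL(2, S)) ∉ lowerSL2 R S π) →
      ((l ++ [z]).map fun x => (x.2 : SL(2, S))).prod ∉ imageSL2 R S := by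
    intro l z hz hc hl hmem
    obtain ⟨y, hy⟩ : ∃ y, y ∈ (l ++ [z]).head? := by
      cases l <;> simp
    have hzB : (z.2 : SL(2, S)) ∈ twistedSL2 R S π := by
      obtain ⟨i, b⟩ := z
      subst hz
      exact b.2
    obtain ⟨n, hn⟩ := pingPong_prod hπ hinj hzB (hl z (by simp)) l z hz rfl hc
      (fun x hx => hl x (List.mem_append_left _ hx)) y hy
    exact hn.not_integral hinj (imageSL2_mulVec_mem_one hinj hmem)
  rcases l.eq_nil_or_concat' with rfl | ⟨l, z, rfl⟩
  · rfl
  exfalso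
  -- A last letter from A can be dropped without changing membership in A; what remains ends in B,
  -- or is empty, in which case that letter itself would lie in U.
  by_cases hz : z.1 = 1
  · exact main l z hz hchain hl (hUA hprod)
  have hzA : (z.2 : SL(2, S)) ∈ imageSL2 R S := by
    obtain ⟨i, a⟩ := z
    obtain rfl : i = 0 := not_not.1 fun h => hz (i.eq_one_of_ne_zero h)
    exact a.2
  rcases l.eq_nil_or_concat' with rfl | ⟨l, y, rfl⟩
  · exact hl z (by simp) (by simpa using hprod)
  have hyz : y.1 ≠ z.1 := by
    rw [List.isChain_append] at hchain
    exact hchain.2.2 y (by simp) z (by simp)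
  have hy : y.1 = 1 := by lia
  refine main l y hy (List.isChain_append.1 hchain).1
    (fun x hx => hl x (List.mem_append_left _ hx)) ?_
  rw [List.map_append, List.prod_append] at hprod
  refine (Subgroup.mul_mem_cancel_right _ ?_).1 (hUA hprod)
  simpa using hzA

theorem SL2_isAmalgam {π : R} [IsLocalization.Away π S] [IsDomain R] (hπ : Prime π)
    (hred : ResidualReduction π) (hinj : Function.Injective (algebraMap R S)) :
    IsAmalgam (imageSL2 R S) (twistedSL2 R S π) (lowerSL2 R S π) := by
  have hU := lowerSL2_eq_inf (S := S) π hinj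
  have h : ∀ i : Fin 2, lowerSL2 R S π ≤ ![imageSL2 R S, twistedSL2 R S π] i := by
    intro i
    fin_cases i
    · exact hU.le.trans inf_le_left
    · exact hU.le.trans inf_le_right
  refine ⟨hU, h, amalgamToGroup_SL2_injective hπ hinj h, ?_⟩
  rw [← MonoidHom.range_eq_top, eq_top_iff, ← imageSL2_sup_twistedSL2 π hπ hred hinj]
  refine sup_le (fun g hg => ⟨Monoid.PushoutI.of 0 ⟨g, hg⟩, ?_⟩)
    (fun g hg => ⟨Monoid.PushoutI.of 1 ⟨g, hg⟩, ?_⟩)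
  · exact Monoid.PushoutI.lift_of ..
  · exact Monoid.PushoutI.lift_of ..

end Localization

/-- Generation and amalgam decomposition of `SL₂(R[1/π])`, where `S = R[1/π]`. -/
theorem mainTheorem6 (R : Type u) [CommRing R] (π : R)
    (hR : (IsDedekindDomain R ∧ Prime π) ∨
      ∃ (R₀ : Type u) (_ : CommRing R₀) (_ : IsDomain R₀) (_ : IsBezout R₀)
        (e : R₀[X] ≃+* R), π = e X)
    (S : Type v) [CommRing S] [Algebra R S] [IsLocalization.Away π S] :
    (⊤ : Subgroup SL(2, S)) = Subgroup.closure ((imageSL2 R S : Set SL(2, S)) ∪ conjSL2 R S π) ∧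
    IsAmalgam (imageSL2 R S) (twistedSL2 R S π) (lowerSL2 R S π) := by
  obtain ⟨_, hπ, hred⟩ : ∃ _ : IsDomain R, Prime π ∧ ResidualReduction π := by
    rcases hR with ⟨_, hπ⟩ | ⟨R₀, _, _, _, e, rfl⟩
    · exact ⟨inferInstance, hπ, .of_isDedekindDomain hπ⟩
    · exact ⟨e.symm.injective.isDomain e.symm.toRingHom, (MulEquiv.prime_iff e).2 prime_X,
        (ResidualReduction.X_of_isBezout R₀).map_ringEquiv e⟩
  have hinj : Function.Injective (algebraMap R S) :=
    IsLocalization.injective S (powers_le_nonZeroDivisors_of_noZeroDivisors hπ.ne_zero)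
  refine ⟨?_, SL2_isAmalgam hπ hred hinj⟩
  symm
  rw [eq_top_iff, ← imageSL2_sup_twistedSL2 π hπ hred hinj]
  refine sup_le (fun g hg => ?_) (fun g hg => ?_)
  · exact Subgroup.subset_closure (Or.inl hg)
  · exact Subgroup.subset_closure (Or.inr (twistedSL2_subset_conjSL2 π hinj hg))
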